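/- **Setting.** Let $X$ be a set of instances, let labels be binary, coded as $y\in\{-1,1\}$, and let $P$ be a probability measure on $D=X\times\{-1,1\}$, on a $\sigma$-algebra for which the label map $(x,y)\mapsto y$ is measurable. Fix training examples $(x_1,y_1),\dots,(x_m,y_m)$ and a nonempty (finite or infinite) set $\mathcal H$ of hypotheses $h:X\to\{-1,1\}$. Each $h\in\mathcal H$ gives a row $\eta\in\{0,1\}^m$, $\eta(i)=\mathbf 1[h(x_i)\ne y_i]$; let $M$ be the finite set of these rows. Fix a tie-breaking function that picks an element of every nonempty subset of $M$ and, for each $\eta\in M$, one representative $h^\eta\in\mathcal H$ with row $\eta$ (the weak learner always answers with $h^\eta$ when the row $\eta$ is selected). For $w$ in the simplex $\Delta_m$ put $\epsilon(w)=\min_{\eta\in M}\eta\cdot w$, $\alpha(w)=\frac12\log\frac{1-\epsilon(w)}{\epsilon(w)}$, and let $\eta^w$ be the row picked from $\operatorname{argmin}_{\eta\in M}\eta\cdot w$. On $U=\{w\in\Delta_m: 0<\epsilon(w)<1\}$ the (Optimal) AdaBoost update is $\mathcal A(w)=\mathcal T_{\eta^w}(w)$, where $$[\mathcal T_\eta(w)]_i=\tfrac12\,w(i)\Bigl(\tfrac1{\eta\cdot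 w}\Bigr)^{\eta(i)}\Bigl(\tfrac1{1-\eta\cdot w}\Bigr)^{1-\eta(i)} .$$ An initial weight $w_1$ is admissible if all iterates $w_t=\mathcal A^{(t-1)}(w_1)$, $t\ge1$, exist and lie in $U$. For such $w_1$ let $$F_T(x)=\sum_{t=1}^T\alpha(w_t)\,h^{\eta^{w_t}}(x),\qquad H_T(x)=\operatorname{sign}F_T(x)\quad(\operatorname{sign}0=0),$$ and $\mathrm{err}_D(H)=\int_D\frac{1-yH(x)}2\,dP$. An *invariant measure* is a Borel probability measure $\mu$ on the weights with $\mu(U)=1$ that is preserved by $\mathcal A$. Let $\Omega_\infty=\bigcap_{t\ge1}\mathcal A^{(t)}(\Delta_m)$, where $\mathcal A^{(t)}(\Delta_m)$ is the image under the partial map $\mathcal A^{(t)}$, and $\sigma(\eta)=\{w\in\Delta_m:\eta\in\operatorname{argmin}_{\eta'\in M}\eta'\cdot w\}$. *No ties* means: there is a compact $G\subseteq\Delta_m$ with $\Omega_\infty\subseteq G$ such that for all $\eta,\eta'\in M$ either $\sigma(\eta)\cap\sigma(\eta')\cap G=\emptyset$, or $\sum_{i:\eta(i)\ne\eta'(i)}w(i)=0$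 for all $w\in G$. **Theorem.** 1. If there are no ties and $\Omega_\infty\neq\emptyset$, then an invariant measure exists. 2. For every invariant measure $\mu$ and $\mu$-almost every $w_1$, the weight $w_1$ is admissible and $F^*(x)=\lim_{T\to\infty}\frac1TF_T(x)$ exists (in $\mathbb R$) for every $x\in X$. 3. Let $w_1$ be any admissible initial weight such that each $H_T$ is measurable (as a function on $D$), and suppose that for $P$-almost every $(x,y)$ the limit $F^*(x)=\lim_{T\to\infty}\frac1TF_T(x)$ exists and is nonzero. Put $H^*=\operatorname{sign}F^*$ (with $F^*$ given arbitrary values where the limit does not exist). Then $H_T(x)\to H^*(x)$ for $P$-almost every $(x,y)$, the functions $\frac{1-yH_T(x)}2$ and $\frac{1-yH^*(x)}2$ are $P$-integrable, and the generalization error of the AdaBoost classifier converges: $$\lim_{T\to\infty}\mathrm{err}_D(H_T)=\int_D\frac{1-yH^*(x)}2\,dP .$$ In particular, for every invariant measure $\mu$ and $\mu$-almost every $w_1$: if each $H_T$ is measurable and $F^*\ne0$ $P$-almost everywhere, then $\mathrm{err}_D(H_T)$ converges to $\int_D\frac{1-yH^*(x)}2\,dP$. -/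

import Mathlib

open MeasureTheory Filter Topology

noncomputable section

namespace AdaBoost

/-- The real number `±1` attached to a binary label: `true ↦ 1`, `false ↦ -1`. -/
def pm (b : Bool) : ℝ := if b then 1 else -1

/-- The row of the error matrix belonging to the hypothesis `h`: its `i`-th entry is `true`
(that is, `1`) exactly when `h` misclassifies the `i`-th training example. -/
def mistakes {X : Type*} {m : ℕ} (x : Fin m → X) (y : Fin m → Bool) (h : X → Bool) :
    Fin m → Bool :=
  fun i => decide (h (x i) ≠ y i)

/-- The fixed data of Optimal AdaBoost: a finite training sample, a nonempty (finite or infinite)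
class of hypotheses, a tie-breaking function on sets of rows of the error matrix, and a weak
learner that has one fixed representative hypothesis for every row. -/
structure Setup (X : Type*) (m : ℕ) where
  /-- the training instances -/
  x : Fin m → X
  /-- the training labels -/
  y : Fin m → Bool
  /-- the hypothesis class -/
  hyps : Set (X → Bool)
  hyps_nonempty : hyps.Nonempty
  /-- the tie-breaking function -/
  adaSelect : Set (Fin m → Bool) → (Fin m → Bool)
  adaSelect_mem : ∀ N : Set (Fin m → Bool),
    N ⊆ mistakes x y '' hyps → N.Nonempty → adaSelect N ∈ N
  /-- the representative hypothesis of a row -/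
  rep : (Fin m → Bool) → (X → Bool)
  rep_mem : ∀ η ∈ mistakes x y '' hyps, rep η ∈ hyps
  mistakes_rep : ∀ η ∈ mistakes x y '' hyps, mistakes x y (rep η) = η

/-- The weighted error `η · w` of a row. -/
def rowErr {m : ℕ} (η : Fin m → Bool) (w : Fin m → ℝ) : ℝ :=
  ∑ i, if η i then w i else 0

/-- The hypothetical weight update: the update that AdaBoost makes if it selects the row `η`. -/
def hypUpdate {m : ℕ} (η : Fin m → Bool) (w : Fin m → ℝ) : Fin m → ℝ :=
  fun i => 1 / 2 * w i * (if η i then 1 / rowErr η w else 1 / (1 - rowErr η w))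

namespace Setup

variable {X : Type*} {m : ℕ} (S : Setup X m)

/-- The set of rows of the error matrix. -/
def rows : Set (Fin m → Bool) := mistakes S.x S.y '' S.hyps

/-- The rows with the least weighted error. -/
def argminRows (w : Fin m → ℝ) : Set (Fin m → Bool) :=
  {η | η ∈ S.rows ∧ ∀ η' ∈ S.rows, rowErr η w ≤ rowErr η' w}

/-- The row that AdaBoost selects at the weight `w`. -/
def best (w : Fin m → ℝ) : Fin m → Bool := S.adaSelect (S.argminRows w)

/-- The least weighted error of a row. -/
def eps (w : Fin m → ℝ) : ℝ := sInf ((fun η => rowErr η w) '' S.rows)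

/-- The coefficient that AdaBoost gives to the selected hypothesis. -/
def alpha (w : Fin m → ℝ) : ℝ := 1 / 2 * Real.log ((1 - S.eps w) / S.eps w)

/-- The AdaBoost weight update. -/
def update (w : Fin m → ℝ) : Fin m → ℝ := hypUpdate (S.best w) w

/-- The weights in the simplex at which the update and its coefficient are defined: the
selected row has neither error `0` nor error `1`. -/
def dom : Set (Fin m → ℝ) := {w | w ∈ stdSimplex ℝ (Fin m) ∧ 0 < S.eps w ∧ S.eps w < 1}

/-- AdaBoost started at `w₁` never leaves the domain of the update. -/
def IsRun (w₁ : Fin m → ℝ) : Prop := ∀ t : ℕ, S.update^[t] w₁ ∈ S.dom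

/-- The image of the simplex under the `t`-th iterate of the (partially defined) update. -/
def reach : ℕ → Set (Fin m → ℝ)
  | 0 => stdSimplex ℝ (Fin m)
  | t + 1 => S.update '' (reach t ∩ S.dom)

/-- The weights that AdaBoost can reach at every time. -/
def attractor : Set (Fin m → ℝ) := ⋂ t ∈ Set.Ici 1, S.reach t

/-- The weights at which the row `η` is among the rows of least error. -/
def sigma (η : Fin m → Bool) : Set (Fin m → ℝ) :=
  {w | w ∈ stdSimplex ℝ (Fin m) ∧ η ∈ S.argminRows w}

/-- Optimal AdaBoost eventually has no ties. -/
def NoTies : Prop :=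
  ∃ G : Set (Fin m → ℝ), G ⊆ stdSimplex ℝ (Fin m) ∧ IsCompact G ∧ S.attractor ⊆ G ∧
    ∀ η ∈ S.rows, ∀ η' ∈ S.rows,
      S.sigma η ∩ S.sigma η' ∩ G = ∅ ∨
        ∀ w ∈ G, ∑ i, (if η i ≠ η' i then w i else 0) = 0

/-- `μ` is a Borel probability measure on the weights at which the update is defined, and is
invariant under the update. -/
def IsInvariant (μ : Measure (Fin m → ℝ)) : Prop :=
  IsProbabilityMeasure μ ∧ μ S.domᶜ = 0 ∧ MeasurePreserving S.update μ μ

/-- The combined function `F_T(x) = ∑_{t=1}^T α_t h_t(x)` of the run started at `w₁`, where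
the weight of round `t` is the `(t-1)`-st iterate of the update at `w₁`. -/
def F (w₁ : Fin m → ℝ) (T : ℕ) (x : X) : ℝ :=
  ∑ t ∈ Finset.range T,
    S.alpha (S.update^[t] w₁) * pm (S.rep (S.best (S.update^[t] w₁)) x)

/-- The AdaBoost classifier `H_T(x) = sign (F_T(x))`. -/
def H (w₁ : Fin m → ℝ) (T : ℕ) (x : X) : ℝ := Real.sign (S.F w₁ T x)

end Setup

/-- The pointwise error `(1 - y H(x)) / 2` of a classifier on a labelled example. -/
def loss {X : Type*} (H : X → ℝ) (z : X × Bool) : ℝ := (1 - pm z.2 * H z.1) / 2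

/-- The generalization error of a classifier. -/
def genErr {X : Type*} [MeasurableSpace (X × Bool)] (P : Measure (X × Bool)) (H : X → ℝ) : ℝ :=
  ∫ z, loss H z ∂P

end AdaBoost

end

/-! Two ergodic theorems and one bound on the dynamics carry the result. An update multiplies each
weight by at least 1/2, so no row's error drops below half its value, while the row just selected
gets error exactly 1/2. Among 2^m + 1 consecutive rounds some row is selected twice; at its second
selection its error, which is then the minimum, is still bounded below. So after 2^m rounds every
run lies in the compact set `core`, inside the domain and with bounded coefficients
(`pow_le_eps_iterate`).

Existence: the closure of the attractor is compact and inside `core`. Without ties, rows minimal at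
a common point of G induce the same update on G, so the update is continuous on that closure, and
Krylov-Bogoliubov gives an invariant measure.

Averages: by invariance almost every orbit stays in `core`. Sorting the rounds by selected row
writes F_T as a finite combination of Birkhoff sums of bounded functions of the weight, to which
Birkhoff's theorem applies.

Error: a nonzero limit of F_T / T fixes the sign of F_T eventually, and dominated convergence passes
to the integrals. -/

/-! ### The maximal ergodic theorem. -/

/-- The maximum of `0` and of the first `n` Birkhoff sums of `f` along the orbits of `T`. -/
noncomputable def birkhoffMax {α : Type*} (T : α → α) (f : α → ℝ) : ℕ → α → ℝ
  | 0 => fun _ => 0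
  | n + 1 => fun x => max 0 (f x + birkhoffMax T f n (T x))

section BirkhoffMax

variable {α : Type*} {T : α → α} {f : α → ℝ}

theorem birkhoffMax_nonneg (n : ℕ) (x : α) : 0 ≤ birkhoffMax T f n x := by
  cases n with
  | zero => exact le_rfl
  | succ n => exact le_max_left _ _

theorem birkhoffMax_le_succ (n : ℕ) (x : α) :
    birkhoffMax T f n x ≤ birkhoffMax T f (n + 1) x := by
  induction n generalizing x with
  | zero => exact birkhoffMax_nonneg 1 x
  | succ n ih =>
    refine max_le_max le_rfl ?_
    have := ih (T x)
    linarith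

theorem birkhoffMax_mono (x : α) : Monotone fun n => birkhoffMax T f n x :=
  monotone_nat_of_le_succ fun n => birkhoffMax_le_succ n x

theorem birkhoffSum_le_birkhoffMax (n : ℕ) (x : α) :
    birkhoffSum T f n x ≤ birkhoffMax T f n x := by
  induction n generalizing x with
  | zero => simp [birkhoffMax]
  | succ n ih =>
    rw [birkhoffSum_succ']
    refine le_trans ?_ (le_max_right _ _)
    have := ih (T x)
    linarith

variable [MeasurableSpace α] {μ : Measure α}

theorem measurable_birkhoffMax (hT : Measurable T) (hf : Measurable f) (n : ℕ) :
    Measurable (birkhoffMax T f n) := by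
  induction n with
  | zero => exact measurable_const
  | succ n ih => exact measurable_const.max (hf.add (ih.comp hT))

theorem integrable_birkhoffMax (hT : MeasurePreserving T μ μ) (hf : Integrable f μ) (n : ℕ) :
    Integrable (birkhoffMax T f n) μ := by
  induction n with
  | zero => exact integrable_zero _ _ _
  | succ n ih =>
    exact (integrable_zero _ _ _).sup (hf.add (hT.integrable_comp_of_integrable ih))

/-- Garsia's argument. Let M_n be `birkhoffMax T f n`. Where M_{n+1} > 0 the recursion gives f =
M_{n+1} - M_n ∘ T; elsewhere M_{n+1} - M_n ∘ T ≤ 0. By invariance this difference has integral ∫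
M_{n+1} - ∫ M_n ≥ 0. -/
theorem setIntegral_birkhoffMax_pos_nonneg (hT : MeasurePreserving T μ μ) (hfm : Measurable f)
    (hf : Integrable f μ) (n : ℕ) :
    0 ≤ ∫ x in {x | 0 < birkhoffMax T f n x}, f x ∂μ := by
  cases n with
  | zero => simp [birkhoffMax]
  | succ n =>
    have hM := integrable_birkhoffMax hT hf n
    have hMT : Integrable (fun x => birkhoffMax T f n (T x)) μ :=
      hT.integrable_comp_of_integrable hM
    have hM1 := integrable_birkhoffMax hT hf (n + 1)
    have hs : MeasurableSet {x | 0 < birkhoffMax T f (n + 1) x} :=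
      measurableSet_lt measurable_const (measurable_birkhoffMax hT.measurable hfm (n + 1))
    have hcomp : ∫ x, birkhoffMax T f n (T x) ∂μ = ∫ x, birkhoffMax T f n x ∂μ := by
      rw [← integral_map hT.measurable.aemeasurable, hT.map_eq]
      rw [hT.map_eq]
      exact hM.aestronglyMeasurable
    calc 0 ≤ ∫ x, (birkhoffMax T f (n + 1) x - birkhoffMax T f n (T x)) ∂μ := by
          rw [integral_sub hM1 hMT, hcomp, sub_nonneg]
          exact integral_mono hM hM1 (birkhoffMax_le_succ n)
      _ ≤ ∫ x, {x | 0 < birkhoffMax T f (n + 1) x}.indicator f x ∂μ := by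
          refine integral_mono (hM1.sub hMT) (hf.indicator hs) fun x => ?_
          by_cases hx : 0 < birkhoffMax T f (n + 1) x
          · have hx' : x ∈ {x | 0 < birkhoffMax T f (n + 1) x} := hx
            simp only [Set.indicator_of_mem hx']
            have : birkhoffMax T f (n + 1) x = max 0 (f x + birkhoffMax T f n (T x)) := rfl
            rcases max_choice 0 (f x + birkhoffMax T f n (T x)) with h | h <;> linarith
          · have hx' : x ∉ {x | 0 < birkhoffMax T f (n + 1) x} := hx
            simp only [Set.indicator_of_notMem hx']
            have := birkhoffMax_nonneg (T := T) (f := f) n (T x)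
            linarith
      _ = _ := integral_indicator hs

/-- The maximal ergodic theorem. -/
theorem integral_nonneg_of_ae_exists_birkhoffSum_pos (hT : MeasurePreserving T μ μ)
    (hfm : Measurable f) (hf : Integrable f μ) (h : ∀ᵐ x ∂μ, ∃ n, 0 < birkhoffSum T f n x) :
    0 ≤ ∫ x, f x ∂μ := by
  have hs : ∀ n, MeasurableSet {x | 0 < birkhoffMax T f n x} := fun n =>
    measurableSet_lt measurable_const (measurable_birkhoffMax hT.measurable hfm n)
  -- The sets where M_n > 0 increase with n and by `h` exhaust the space up to a null set.
  have hlim : Tendsto (fun n => ∫ x, {x | 0 < birkhoffMax T f n x}.indicator f x ∂μ) atTop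
      (𝓝 (∫ x, f x ∂μ)) := by
    refine tendsto_integral_of_dominated_convergence (fun x => ‖f x‖)
      (fun n => (hf.indicator (hs n)).aestronglyMeasurable) hf.norm
      (fun n => ae_of_all _ fun x => norm_indicator_le_norm_self f x) ?_
    filter_upwards [h] with x ⟨n, hn⟩
    refine tendsto_const_nhds.congr' ?_
    filter_upwards [eventually_ge_atTop n] with k hk
    rw [Set.indicator_of_mem]
    exact hn.trans_le ((birkhoffSum_le_birkhoffMax n x).trans (birkhoffMax_mono x hk))
  refine ge_of_tendsto' hlim fun n => ?_
  rw [integral_indicator (hs n)]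
  exact setIntegral_birkhoffMax_pos_nonneg hT hfm hf n

end BirkhoffMax

/-! ### Birkhoff's pointwise ergodic theorem for bounded functions. -/

section PointwiseErgodic

variable {α : Type*} {T : α → α} {f : α → ℝ} {C : ℝ}

/-- The points whose Birkhoff averages have an upper limit greater than `b`. -/
def birkhoffAbove (T : α → α) (f : α → ℝ) (b : ℝ) : Set α :=
  {x | ∃ q : ℚ, b < q ∧ ∃ᶠ n in atTop, (q : ℝ) < birkhoffSum T f n x / n}

theorem abs_birkhoffSum_div_le (hC : ∀ x, |f x| ≤ C) (n : ℕ) (x : α) :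
    |birkhoffSum T f n x / n| ≤ C := by
  have hC0 : 0 ≤ C := (abs_nonneg _).trans (hC x)
  rw [abs_div, Nat.abs_cast]
  refine div_le_of_le_mul₀ n.cast_nonneg hC0 ?_
  calc |birkhoffSum T f n x| ≤ ∑ k ∈ Finset.range n, |f (T^[k] x)| :=
        Finset.abs_sum_le_sum_abs _ _
    _ ≤ ∑ _k ∈ Finset.range n, C := Finset.sum_le_sum fun k _ => hC _
    _ = C * n := by simp [mul_comm]

theorem tendsto_birkhoffSum_div_apply_sub (hC : ∀ x, |f x| ≤ C) (x : α) :
    Tendsto (fun n : ℕ => birkhoffSum T f n (T x) / n - birkhoffSum T f n x / n) atTop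
      (𝓝 0) := by
  refine squeeze_zero_norm (a := fun n : ℕ => 2 * C / n) (fun n => ?_)
    (tendsto_const_div_atTop_nhds_zero_nat _)
  rw [← sub_div, birkhoffSum_apply_sub_birkhoffSum, Real.norm_eq_abs, abs_div, Nat.abs_cast]
  gcongr
  calc |f (T^[n] x) - f x| ≤ |f (T^[n] x)| + |f x| := abs_sub _ _
    _ ≤ 2 * C := by linarith [hC (T^[n] x), hC x]

/-- A rational strictly between b and q absorbs the vanishing difference. This makes `birkhoffAbove`
invariant under T. -/
theorem exists_rat_frequently_of_tendsto_sub {u v : ℕ → ℝ} {b : ℝ}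
    (h : Tendsto (fun n => u n - v n) atTop (𝓝 0))
    (hv : ∃ q : ℚ, b < q ∧ ∃ᶠ n in atTop, (q : ℝ) < v n) :
    ∃ q : ℚ, b < q ∧ ∃ᶠ n in atTop, (q : ℝ) < u n := by
  obtain ⟨q, hq, hf⟩ := hv
  obtain ⟨r, hr, hrq⟩ := exists_rat_btwn hq
  refine ⟨r, hr, ?_⟩
  have h1 : ∀ᶠ n in atTop, (r : ℝ) - q < u n - v n :=
    h.eventually (lt_mem_nhds (sub_neg.2 hrq))
  refine (hf.and_eventually h1).mono fun n hn => ?_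
  linarith [hn.1, hn.2]

theorem preimage_birkhoffAbove (hC : ∀ x, |f x| ≤ C) (b : ℝ) :
    T ⁻¹' birkhoffAbove T f b = birkhoffAbove T f b := by
  ext x
  have h := tendsto_birkhoffSum_div_apply_sub (T := T) hC x
  refine ⟨exists_rat_frequently_of_tendsto_sub ?_, exists_rat_frequently_of_tendsto_sub h⟩
  simpa using h.neg

variable [MeasurableSpace α] {μ : Measure α}

theorem measurable_birkhoffSum (hT : Measurable T) (hf : Measurable f) (n : ℕ) :
    Measurable (birkhoffSum T f n) :=
  Finset.measurable_sum _ fun k _ => hf.comp (hT.iterate k)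

theorem measurableSet_birkhoffAbove (hT : Measurable T) (hf : Measurable f) (b : ℝ) :
    MeasurableSet (birkhoffAbove T f b) := by
  have : birkhoffAbove T f b = ⋃ q : ℚ, ⋃ _ : b < q, ⋂ N : ℕ, ⋃ n : ℕ, ⋃ _ : N ≤ n,
      {x | (q : ℝ) < birkhoffSum T f n x / n} := by
    ext x
    simp [birkhoffAbove, frequently_atTop]
  rw [this]
  refine .iUnion fun q => .iUnion fun _ => .iInter fun N => .iUnion fun n => .iUnion fun _ => ?_
  exact measurableSet_lt measurable_const ((measurable_birkhoffSum hT hf n).div_const _)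

/-- The maximal ergodic theorem for f - b and the restriction of μ to E, which T preserves because E
is an invariant set. -/
theorem mul_measureReal_le_setIntegral [IsFiniteMeasure μ] (hT : MeasurePreserving T μ μ)
    (hfm : Measurable f) (hC : ∀ x, |f x| ≤ C) {b : ℝ} {E : Set α} (hE : MeasurableSet E)
    (hTE : T ⁻¹' E = E) (hEb : E ⊆ birkhoffAbove T f b) :
    b * μ.real E ≤ ∫ x in E, f x ∂μ := by
  have hTr : MeasurePreserving T (μ.restrict E) (μ.restrict E) := by
    have := hT.restrict_preimage hE
    rwa [hTE] at this
  have hf : Integrable f (μ.restrict E) :=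
    Integrable.of_bound hfm.aestronglyMeasurable C (ae_of_all _ hC)
  have key : 0 ≤ ∫ x in E, (f x - b) ∂μ := by
    refine integral_nonneg_of_ae_exists_birkhoffSum_pos hTr (hfm.sub_const b)
      (hf.sub (integrable_const b)) ?_
    filter_upwards [ae_restrict_mem hE] with x hx
    obtain ⟨q, hq, hx⟩ := hEb hx
    obtain ⟨n, hn, hn0⟩ := (hx.and_eventually (eventually_gt_atTop 0)).exists
    refine ⟨n, ?_⟩
    have hn0' : (0 : ℝ) < n := Nat.cast_pos.2 hn0
    have h1 := (lt_div_iff₀ hn0').1 (hq.trans hn)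
    have : birkhoffSum T (fun x => f x - b) n x = birkhoffSum T f n x - b * n := by
      simp [birkhoffSum, Finset.sum_sub_distrib, mul_comm]
    linarith
  rw [integral_sub hf (integrable_const b), setIntegral_const, smul_eq_mul] at key
  linarith

/-- The set E where the averages have lower limit below a and upper limit above b is invariant, so b
μ(E) ≤ ∫_E f ≤ a μ(E), which forces μ(E) = 0. -/
theorem measure_birkhoffAbove_inter_eq_zero [IsFiniteMeasure μ] (hT : MeasurePreserving T μ μ)
    (hfm : Measurable f) (hC : ∀ x, |f x| ≤ C) {a b : ℝ} (hab : a < b) :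
    μ (birkhoffAbove T f b ∩ birkhoffAbove T (-f) (-a)) = 0 := by
  set E := birkhoffAbove T f b ∩ birkhoffAbove T (-f) (-a)
  have hC' : ∀ x, |(-f) x| ≤ C := fun x => by simpa using hC x
  have hE : MeasurableSet E := (measurableSet_birkhoffAbove hT.measurable hfm b).inter
    (measurableSet_birkhoffAbove hT.measurable hfm.neg (-a))
  have hTE : T ⁻¹' E = E := by
    rw [Set.preimage_inter, preimage_birkhoffAbove hC, preimage_birkhoffAbove hC']
  have h1 := mul_measureReal_le_setIntegral hT hfm hC hE hTE Set.inter_subset_left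
  have h2 := mul_measureReal_le_setIntegral hT hfm.neg hC' hE hTE Set.inter_subset_right
  simp only [Pi.neg_apply, integral_neg] at h2
  have h3 : μ.real E = 0 := by
    have := measureReal_nonneg (μ := μ) (s := E)
    nlinarith
  exact (measureReal_eq_zero_iff).1 h3

/-- Birkhoff's pointwise ergodic theorem for bounded functions. -/
theorem ae_exists_tendsto_birkhoffSum_div [IsFiniteMeasure μ] (hT : MeasurePreserving T μ μ)
    (hfm : Measurable f) (hC : ∀ x, |f x| ≤ C) :
    ∀ᵐ x ∂μ, ∃ l, Tendsto (fun n : ℕ => birkhoffSum T f n x / n) atTop (𝓝 l) := by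
  have h : ∀ᵐ x ∂μ, ∀ a b : ℚ, a < b →
      x ∉ birkhoffAbove T f b ∩ birkhoffAbove T (-f) (-a) := by
    simp only [ae_all_iff]
    intro a b hab
    exact measure_eq_zero_iff_ae_notMem.1
      (measure_birkhoffAbove_inter_eq_zero hT hfm hC (Rat.cast_lt.2 hab))
  filter_upwards [h] with x hx
  refine tendsto_of_no_upcrossings (s := Set.range ((↑) : ℚ → ℝ)) Rat.denseRange_cast ?_
    (isBoundedUnder_of ⟨C, fun n => (abs_le.1 (abs_birkhoffSum_div_le hC n x)).2⟩)
    (isBoundedUnder_of ⟨-C, fun n => (abs_le.1 (abs_birkhoffSum_div_le hC n x)).1⟩)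
  rintro _ ⟨a, rfl⟩ _ ⟨b, rfl⟩ hab ⟨ha, hb⟩
  -- The endpoints are moved strictly inside (a, b), since `birkhoffAbove` asks for a rational
  -- strictly beyond its threshold; b and -a then serve as those rationals.
  obtain ⟨a', ha', hab'⟩ := exists_rat_btwn hab
  obtain ⟨b', ha'b', hb'⟩ := exists_rat_btwn hab'
  refine hx a' b' (by exact_mod_cast ha'b') ⟨⟨b, hb', hb⟩, -a, ?_, ?_⟩
  · push_cast
    linarith
  · refine ha.mono fun n hn => ?_
    rw [birkhoffSum_neg, neg_div]
    push_cast
    linarith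

end PointwiseErgodic

/-! ### Invariant measures of continuous maps on compact spaces. -/

section KrylovBogoliubov

variable {E : Type*} [MeasurableSpace E]

/-- The uniform distribution on the first `n + 1` points of an orbit. -/
noncomputable def orbitMeasure (T : E → E) (x : E) (n : ℕ) : Measure E :=
  (n + 1 : ENNReal)⁻¹ • ∑ k ∈ Finset.range (n + 1), Measure.dirac (T^[k] x)

instance isProbabilityMeasure_orbitMeasure (T : E → E) (x : E) (n : ℕ) :
    IsProbabilityMeasure (orbitMeasure T x n) := by
  constructor
  simp only [orbitMeasure, Measure.smul_apply, Measure.finsetSum_apply, measure_univ, smul_eq_mul]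
  simp only [Finset.sum_const, Finset.card_range, nsmul_eq_mul, mul_one, Nat.cast_add, Nat.cast_one]
  exact ENNReal.inv_mul_cancel (by simp) (by finiteness)

variable [TopologicalSpace E] [BorelSpace E]

theorem integral_orbitMeasure (T : E → E) (x : E) (n : ℕ)
    {f : E → ℝ} (hf : Continuous f) :
    ∫ y, f y ∂orbitMeasure T x n = birkhoffSum T f (n + 1) x / (n + 1) := by
  have hd : ∀ y : E, Integrable f (Measure.dirac y) := fun y =>
    integrable_dirac' hf.measurable.stronglyMeasurable (by finiteness)
  rw [orbitMeasure, integral_smul_measure, integral_finsetSum_measure fun k _ => hd _]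
  simp only [integral_dirac' _ _ hf.measurable.stronglyMeasurable]
  rw [smul_eq_mul, ENNReal.toReal_inv, birkhoffSum, div_eq_inv_mul]
  norm_cast

/-- The Krylov-Bogoliubov theorem. -/
theorem exists_measurePreserving_of_continuous [CompactSpace E] [T2Space E]
    [HasOuterApproxClosed E] [Nonempty E] {T : E → E} (hT : Continuous T) :
    ∃ μ : Measure E, IsProbabilityMeasure μ ∧ MeasurePreserving T μ μ := by
  obtain ⟨x⟩ := ‹Nonempty E›
  let ν : ℕ → ProbabilityMeasure E := fun n => ⟨orbitMeasure T x n, inferInstance⟩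
  -- A limit along an ultrafilter replaces the choice of a convergent subsequence of the empirical
  -- measures.
  obtain ⟨μ, -, hμ⟩ := isCompact_univ (X := ProbabilityMeasure E).ultrafilter_le_nhds
    ((hyperfilter ℕ).map ν) (by simp)
  have hμ' : Tendsto ν (hyperfilter ℕ) (𝓝 μ) := hμ
  rw [ProbabilityMeasure.tendsto_iff_forall_integral_tendsto] at hμ'
  refine ⟨μ, inferInstance, hT.measurable, ?_⟩
  have := Measure.isProbabilityMeasure_map (μ := (μ : Measure E)) hT.measurable.aemeasurable
  refine ext_of_forall_integral_eq_of_IsFiniteMeasure fun f => ?_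
  rw [integral_map hT.measurable.aemeasurable f.continuous.measurable.aestronglyMeasurable]
  have h1 := hμ' f
  have h2 := hμ' (f.compContinuous ⟨T, hT⟩)
  have h3 : Tendsto (fun n : ℕ => 2 * ‖f‖ / ((n : ℝ) + 1)) atTop (𝓝 0) := by
    simpa [Function.comp_def] using
      (tendsto_const_div_atTop_nhds_zero_nat (2 * ‖f‖)).comp (tendsto_add_atTop_nat 1)
  -- The two Birkhoff sums telescope to f(T^{n+1} x) - f(x), so their averages differ by at most
  -- 2‖f‖ / (n + 1).
  have h4 : Tendsto (fun n => ∫ y, f (T y) ∂(ν n : Measure E) - ∫ y, f y ∂(ν n : Measure E))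
      (hyperfilter ℕ) (𝓝 0) := by
    refine squeeze_zero_norm (fun n => ?_)
      (h3.mono_left (Nat.hyperfilter_le_atTop))
    change ‖∫ y, f (T y) ∂orbitMeasure T x n - ∫ y, f y ∂orbitMeasure T x n‖ ≤ _
    rw [integral_orbitMeasure T x n f.continuous,
      integral_orbitMeasure T x n (f := fun y => f (T y)) (f.continuous.comp hT), ← sub_div]
    have : birkhoffSum T (fun y => f (T y)) (n + 1) x = birkhoffSum T f (n + 1) (T x) := by
      simp only [birkhoffSum, ← Function.iterate_succ_apply, ← Function.iterate_succ_apply']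
    rw [this, birkhoffSum_apply_sub_birkhoffSum, norm_div]
    have hn : ‖(n : ℝ) + 1‖ = n + 1 := by
      rw [Real.norm_eq_abs, abs_of_nonneg (by positivity)]
    rw [hn]
    gcongr
    refine (norm_sub_le _ _).trans ?_
    linarith [f.norm_coe_le_norm (T^[n + 1] x), f.norm_coe_le_norm x]
  exact sub_eq_zero.1 (tendsto_nhds_unique (h2.sub h1) h4)

end KrylovBogoliubov

namespace AdaBoost

/-! ### The update for a fixed row. -/

section Rows

variable {m : ℕ}

theorem continuous_rowErr (η : Fin m → Bool) : Continuous (rowErr η) := by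
  unfold rowErr
  refine continuous_finsetSum _ fun i _ => ?_
  by_cases h : η i
  · simpa [h] using continuous_apply i
  · simpa [h] using continuous_const

theorem rowErr_eq_of_sum_eq_zero {η η' : Fin m → Bool} {w : Fin m → ℝ} (hw : ∀ i, 0 ≤ w i)
    (h : ∑ i, (if η i ≠ η' i then w i else 0) = 0) (i : Fin m) : η i = η' i ∨ w i = 0 := by
  have := (Finset.sum_eq_zero_iff_of_nonneg fun i _ => by split_ifs <;> simp [hw]).1 h i
    (Finset.mem_univ i)
  by_cases hi : η i = η' i
  · exact Or.inl hi
  · simpa [hi] using this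

/-- The rows differ only at examples of weight zero, which affect neither the error nor the updated
weights. This uses the second alternative in the no-ties condition. -/
theorem hypUpdate_eq_of_sum_eq_zero {η η' : Fin m → Bool} {w : Fin m → ℝ} (hw : ∀ i, 0 ≤ w i)
    (h : ∑ i, (if η i ≠ η' i then w i else 0) = 0) : hypUpdate η w = hypUpdate η' w := by
  have key := rowErr_eq_of_sum_eq_zero hw h
  have hr : rowErr η w = rowErr η' w := Finset.sum_congr rfl fun i _ => by
    rcases key i with h | h <;> simp [h]
  funext i
  rcases key i with h | h <;> simp [hypUpdate, h, hr]

theorem continuousAt_hypUpdate {η : Fin m → Bool} {w : Fin m → ℝ} (h0 : 0 < rowErr η w)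
    (h1 : rowErr η w < 1) : ContinuousAt (hypUpdate η) w := by
  refine continuousAt_pi.2 fun i => ?_
  refine (continuousAt_const.mul (continuous_apply i).continuousAt).mul ?_
  by_cases h : η i
  · simp only [h, if_true]
    exact continuousAt_const.div (continuous_rowErr η).continuousAt h0.ne'
  · simp only [h]
    exact continuousAt_const.div (continuousAt_const.sub (continuous_rowErr η).continuousAt)
      (sub_pos.2 h1).ne'

theorem measurable_hypUpdate (η : Fin m → Bool) : Measurable (hypUpdate η) := by
  have := (continuous_rowErr η).measurable
  refine measurable_pi_lambda _ fun i => ?_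
  refine (measurable_const.mul (measurable_pi_apply i)).mul ?_
  by_cases h : η i
  · simpa [h] using this
  · simpa [h] using this.const_sub 1

/-- Both possible factors are reciprocals of numbers in (0, 1), hence at least 1. -/
theorem half_le_hypUpdate {η : Fin m → Bool} {w : Fin m → ℝ} (hw : ∀ i, 0 ≤ w i)
    (h0 : 0 < rowErr η w) (h1 : rowErr η w < 1) (i : Fin m) :
    w i / 2 ≤ hypUpdate η w i := by
  have h1' : 0 < 1 - rowErr η w := sub_pos.2 h1
  have hf : 1 ≤ if η i then 1 / rowErr η w else 1 / (1 - rowErr η w) := by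
    split_ifs
    · exact (one_le_div h0).2 h1.le
    · exact (one_le_div h1').2 (by linarith)
  unfold hypUpdate
  nlinarith [hw i]

theorem rowErr_hypUpdate_self {η : Fin m → Bool} {w : Fin m → ℝ} (h0 : 0 < rowErr η w) :
    rowErr η (hypUpdate η w) = 1 / 2 := by
  have : rowErr η (hypUpdate η w) = 1 / 2 * (1 / rowErr η w) * rowErr η w := by
    conv_lhs => rw [rowErr]
    conv_rhs => rw [rowErr, Finset.mul_sum]
    refine Finset.sum_congr rfl fun i _ => ?_
    by_cases h : η i
    · simp only [hypUpdate, h, if_true, rowErr]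
      ring
    · simp [h]
  rw [this]
  field_simp

theorem sum_hypUpdate {η : Fin m → Bool} {w : Fin m → ℝ} (hw : ∑ i, w i = 1)
    (h0 : 0 < rowErr η w) (h1 : rowErr η w < 1) : ∑ i, hypUpdate η w i = 1 := by
  have h2 : ∑ i, (if η i then 0 else w i) = 1 - rowErr η w := by
    rw [← hw, rowErr, ← Finset.sum_sub_distrib]
    refine Finset.sum_congr rfl fun i _ => ?_
    split_ifs <;> simp
  have h3 : ∑ i, hypUpdate η w i = rowErr η (hypUpdate η w) +
      1 / 2 * (1 / (1 - rowErr η w)) * ∑ i, (if η i then 0 else w i) := by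
    conv_rhs => rw [rowErr, Finset.mul_sum, ← Finset.sum_add_distrib]
    refine Finset.sum_congr rfl fun i _ => ?_
    by_cases h : η i
    · simp [h]
    · simp only [hypUpdate, h]
      simp
      ring
  have h1' : 1 - rowErr η w ≠ 0 := (sub_pos.2 h1).ne'
  rw [h3, h2, rowErr_hypUpdate_self h0]
  field_simp
  norm_num

end Rows

/-! ### A uniform lower bound for the least error along runs. -/

namespace Setup

variable {X : Type*} {m : ℕ} (S : Setup X m)

theorem rows_nonempty : S.rows.Nonempty := S.hyps_nonempty.image _

theorem argminRows_nonempty (w : Fin m → ℝ) : (S.argminRows w).Nonempty := by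
  obtain ⟨η, hη, h⟩ := S.rows.toFinite.exists_minimalFor (fun η => rowErr η w) _ S.rows_nonempty
  refine ⟨η, hη, fun η' hη' => ?_⟩
  rcases le_total (rowErr η w) (rowErr η' w) with h' | h'
  · exact h'
  · exact h hη' h'

theorem best_mem_argminRows (w : Fin m → ℝ) : S.best w ∈ S.argminRows w :=
  S.adaSelect_mem _ (fun _ h => h.1) (S.argminRows_nonempty w)

theorem eps_le_rowErr {η : Fin m → Bool} (hη : η ∈ S.rows) (w : Fin m → ℝ) :
    S.eps w ≤ rowErr η w :=
  csInf_le (S.rows.toFinite.image _).bddBelow (Set.mem_image_of_mem _ hη)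

theorem eps_eq_rowErr_best (w : Fin m → ℝ) : S.eps w = rowErr (S.best w) w := by
  refine le_antisymm (S.eps_le_rowErr (S.best_mem_argminRows w).1 w) ?_
  refine le_csInf (S.rows_nonempty.image _) ?_
  rintro _ ⟨η, hη, rfl⟩
  exact (S.best_mem_argminRows w).2 η hη

variable {S}

theorem rowErr_best_pos {w : Fin m → ℝ} (hw : w ∈ S.dom) : 0 < rowErr (S.best w) w :=
  S.eps_eq_rowErr_best w ▸ hw.2.1

theorem rowErr_best_lt_one {w : Fin m → ℝ} (hw : w ∈ S.dom) : rowErr (S.best w) w < 1 :=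
  S.eps_eq_rowErr_best w ▸ hw.2.2

theorem half_rowErr_le_rowErr_update {w : Fin m → ℝ} (hw : w ∈ S.dom) (η : Fin m → Bool) :
    rowErr η w / 2 ≤ rowErr η (S.update w) := by
  rw [rowErr, rowErr, Finset.sum_div]
  refine Finset.sum_le_sum fun i _ => ?_
  split_ifs
  · exact half_le_hypUpdate hw.1.1 (rowErr_best_pos hw) (rowErr_best_lt_one hw) i
  · simp

theorem rowErr_best_update {w : Fin m → ℝ} (hw : w ∈ S.dom) :
    rowErr (S.best w) (S.update w) = 1 / 2 :=
  rowErr_hypUpdate_self (rowErr_best_pos hw)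

theorem half_eps_le_eps_update {w : Fin m → ℝ} (hw : w ∈ S.dom) :
    S.eps w / 2 ≤ S.eps (S.update w) := by
  rw [S.eps_eq_rowErr_best (S.update w)]
  refine le_trans ?_ (half_rowErr_le_rowErr_update hw _)
  have := S.eps_le_rowErr (S.best_mem_argminRows (S.update w)).1 w
  linarith

theorem eps_update_le_half {w : Fin m → ℝ} (hw : w ∈ S.dom) : S.eps (S.update w) ≤ 1 / 2 :=
  rowErr_best_update hw ▸ S.eps_le_rowErr (S.best_mem_argminRows w).1 _

theorem update_mem_dom {w : Fin m → ℝ} (hw : w ∈ S.dom) : S.update w ∈ S.dom := by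
  have h0 := rowErr_best_pos hw
  have h1 := rowErr_best_lt_one hw
  refine ⟨⟨fun i => ?_, sum_hypUpdate hw.1.2 h0 h1⟩, ?_, ?_⟩
  · have := half_le_hypUpdate hw.1.1 h0 h1 i
    have := hw.1.1 i
    change 0 ≤ hypUpdate (S.best w) w i
    linarith
  · linarith [half_eps_le_eps_update hw, hw.2.1]
  · linarith [eps_update_le_half hw]

theorem iterate_update_mem_dom {w : Fin m → ℝ} (hw : w ∈ S.dom) (t : ℕ) :
    S.update^[t] w ∈ S.dom := by
  induction t with
  | zero => exact hw
  | succ t ih =>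
    rw [Function.iterate_succ_apply']
    exact update_mem_dom ih

theorem pow_mul_rowErr_le {w : Fin m → ℝ} (hw : w ∈ S.dom) (η : Fin m → Bool) (t : ℕ) :
    (1 / 2) ^ t * rowErr η w ≤ rowErr η (S.update^[t] w) := by
  induction t with
  | zero => simp
  | succ t ih =>
    rw [Function.iterate_succ_apply']
    have := half_rowErr_le_rowErr_update (iterate_update_mem_dom hw t) η
    rw [pow_succ]
    linarith

theorem pow_mul_eps_le {w : Fin m → ℝ} (hw : w ∈ S.dom) (t : ℕ) :
    (1 / 2) ^ t * S.eps w ≤ S.eps (S.update^[t] w) := by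
  rw [S.eps_eq_rowErr_best (S.update^[t] w)]
  refine le_trans ?_ (pow_mul_rowErr_le hw _ t)
  have := S.eps_le_rowErr (S.best_mem_argminRows (S.update^[t] w)).1 w
  gcongr

/-- After as many rounds as there are possible rows, two rounds have selected the same row, so
that the least error is bounded below. -/
theorem pow_le_eps_iterate {w : Fin m → ℝ} (hw : w ∈ S.dom) :
    (1 / 2) ^ 2 ^ m ≤ S.eps (S.update^[2 ^ m] w) := by
  obtain ⟨s, hs, s', hs', hne, heq⟩ := Finset.exists_ne_map_eq_of_card_lt_of_maps_to
    (s := Finset.range (2 ^ m + 1)) (t := (Finset.univ : Finset (Fin m → Bool)))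
    (f := fun s => S.best (S.update^[s] w)) (by simp) (by intro _ _; simp)
  wlog hlt : s < s' generalizing s s'
  · exact this s' hs' s hs hne.symm heq.symm (by omega)
  simp only [Finset.mem_range] at hs'
  obtain ⟨k, rfl⟩ := Nat.exists_eq_add_of_lt hlt
  obtain ⟨l, hl⟩ := Nat.exists_eq_add_of_le (Nat.le_of_lt_succ hs')
  have hws := iterate_update_mem_dom hw s
  -- The row selected at round s has error 1/2 at round s + 1, and k further rounds halve it at most
  -- k times. At round s + k + 1 it is selected again, so its error is the least one; `h2` covers
  -- the remaining l rounds.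
  have h1 := pow_mul_rowErr_le (update_mem_dom hws) (S.best (S.update^[s] w)) k
  rw [rowErr_best_update hws, ← Function.iterate_succ_apply' S.update s w,
    ← Function.iterate_add_apply] at h1
  have h2 := pow_mul_eps_le (iterate_update_mem_dom hw (s + k + 1)) l
  rw [← Function.iterate_add_apply, S.eps_eq_rowErr_best (S.update^[s + k + 1] w)] at h2
  rw [← heq] at h2
  have e1 : k + s.succ = s + k + 1 := by omega
  have e2 : l + (s + k + 1) = 2 ^ m := by omega
  rw [e1] at h1
  rw [e2] at h2
  refine le_trans ?_ h2
  calc ((1 : ℝ) / 2) ^ 2 ^ m ≤ (1 / 2) ^ (l + (k + 1)) :=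
        -- The exponent l + (k + 1) equals 2 ^ m - s.
        pow_le_pow_of_le_one (by norm_num) (by norm_num) (by omega)
    _ = (1 / 2) ^ l * ((1 / 2) ^ k * (1 / 2)) := by ring
    _ ≤ _ := by gcongr

theorem eps_iterate_le_half {w : Fin m → ℝ} (hw : w ∈ S.dom) :
    S.eps (S.update^[2 ^ m] w) ≤ 1 / 2 := by
  obtain ⟨k, hk⟩ := Nat.exists_eq_succ_of_ne_zero (pow_pos two_pos m : 0 < 2 ^ m).ne'
  rw [hk, Function.iterate_succ_apply']
  exact eps_update_le_half (iterate_update_mem_dom hw k)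

theorem exists_iterate_eq_of_mem_reach {t : ℕ} {w : Fin m → ℝ} (hw : w ∈ S.reach (t + 1)) :
    ∃ w₀ ∈ S.dom, S.update^[t + 1] w₀ = w := by
  induction t generalizing w with
  | zero =>
    obtain ⟨w₀, hw₀, rfl⟩ := hw
    exact ⟨w₀, hw₀.2, rfl⟩
  | succ t ih =>
    obtain ⟨w', hw', rfl⟩ := hw
    obtain ⟨w₀, hw₀, rfl⟩ := ih hw'.1
    exact ⟨w₀, hw₀, Function.iterate_succ_apply' _ _ _⟩

theorem mem_reach_of_mem_attractor {w : Fin m → ℝ} (hw : w ∈ S.attractor) {t : ℕ} (ht : 1 ≤ t) :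
    w ∈ S.reach t :=
  Set.mem_iInter₂.1 hw t ht

theorem exists_iterate_eq_of_mem_attractor {w : Fin m → ℝ} (hw : w ∈ S.attractor) :
    ∃ w₀ ∈ S.dom, S.update^[2 ^ m] w₀ = w := by
  obtain ⟨k, hk⟩ := Nat.exists_eq_succ_of_ne_zero (pow_pos two_pos m : 0 < 2 ^ m).ne'
  rw [hk]
  exact exists_iterate_eq_of_mem_reach (mem_reach_of_mem_attractor hw (by omega))

theorem mem_dom_of_mem_attractor {w : Fin m → ℝ} (hw : w ∈ S.attractor) : w ∈ S.dom := by
  obtain ⟨w₀, hw₀, rfl⟩ := exists_iterate_eq_of_mem_attractor hw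
  exact iterate_update_mem_dom hw₀ _

theorem update_mem_attractor {w : Fin m → ℝ} (hw : w ∈ S.attractor) :
    S.update w ∈ S.attractor := by
  have hd := mem_dom_of_mem_attractor hw
  refine Set.mem_iInter₂.2 fun t ht => ?_
  obtain ⟨k, rfl⟩ := Nat.exists_eq_add_of_le' (Set.mem_Ici.1 ht)
  rcases Nat.eq_zero_or_pos k with rfl | hk
  -- The attractor is an intersection over t ≥ 1 only, so membership in `reach 0`, the simplex,
  -- comes from the domain.
  · exact ⟨w, ⟨hd.1, hd⟩, rfl⟩
  · exact ⟨w, ⟨mem_reach_of_mem_attractor hw hk, hd⟩, rfl⟩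

/-! ### Measurability of the update and its coefficient. -/

variable (S)

/-- The set of minimal rows takes finitely many values, each determined by linear inequalities in w;
any tie-breaking function on a finite discrete space is measurable. -/
theorem measurable_best : Measurable S.best := by
  have h : Measurable S.argminRows := by
    refine measurable_set_iff.2 fun η => ?_
    have : MeasurableSet {w | η ∈ S.argminRows w} := by
      have h : {w | η ∈ S.argminRows w} =
          {_w | η ∈ S.rows} ∩ ⋂ η' ∈ S.rows, {w | rowErr η w ≤ rowErr η' w} := by
        ext w
        simp [argminRows]
      rw [h]
      exact (MeasurableSet.const _).inter (.biInter S.rows.to_countable fun η' _ =>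
        measurableSet_le (continuous_rowErr η).measurable (continuous_rowErr η').measurable)
    exact measurableSet_setOfPred.1 this
  exact (measurable_of_countable S.adaSelect).comp h

theorem measurable_of_best {β : Type*} [MeasurableSpace β] {g : (Fin m → Bool) → (Fin m → ℝ) → β}
    (hg : ∀ η, Measurable (g η)) : Measurable fun w => g (S.best w) w :=
  (measurable_from_prod_countable_right hg : Measurable (Function.uncurry g)).comp
    (S.measurable_best.prodMk measurable_id)

theorem measurable_update : Measurable S.update := S.measurable_of_best measurable_hypUpdate

theorem measurable_eps : Measurable S.eps := by
  rw [funext S.eps_eq_rowErr_best]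
  exact S.measurable_of_best fun η => (continuous_rowErr η).measurable

theorem measurable_alpha : Measurable S.alpha :=
  (((S.measurable_eps.const_sub 1).div S.measurable_eps).log).const_mul _

end Setup

end AdaBoost

/-! ### The compact core, invariant measures and limits of averages. -/

namespace AdaBoost

namespace Setup

variable {X : Type*} {m : ℕ} (S : Setup X m)

/-- The weights in the simplex whose least error is bounded below as it is after many rounds. -/
def core : Set (Fin m → ℝ) :=
  {w | w ∈ stdSimplex ℝ (Fin m) ∧ (1 / 2) ^ 2 ^ m ≤ S.eps w ∧ S.eps w ≤ 1 / 2}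

theorem core_subset_dom : S.core ⊆ S.dom := fun w hw =>
  ⟨hw.1, lt_of_lt_of_le (by positivity) hw.2.1, hw.2.2.trans_lt (by norm_num)⟩

theorem iterate_update_mem_core {w : Fin m → ℝ} (hw : w ∈ S.dom) :
    S.update^[2 ^ m] w ∈ S.core :=
  ⟨(iterate_update_mem_dom hw _).1, pow_le_eps_iterate hw, eps_iterate_le_half hw⟩

theorem attractor_subset_core : S.attractor ⊆ S.core := fun w hw => by
  obtain ⟨w₀, hw₀, rfl⟩ := exists_iterate_eq_of_mem_attractor hw
  exact S.iterate_update_mem_core hw₀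

/-- The least error is a minimum over finitely many rows: bounding it below is an intersection of
closed conditions, bounding it above a finite union. -/
theorem isClosed_core : IsClosed S.core := by
  have h : S.core = stdSimplex ℝ (Fin m) ∩ ((⋂ η ∈ S.rows, {w | (1 / 2) ^ 2 ^ m ≤ rowErr η w}) ∩
      ⋃ η ∈ S.rows, {w | rowErr η w ≤ 1 / 2}) := by
    ext w
    simp only [core, Set.mem_inter_iff, Set.mem_ofPred_eq, Set.mem_iInter, Set.mem_iUnion,
      exists_prop]
    refine and_congr_right fun _ => and_congr ?_ ?_
    · exact ⟨fun h η hη => h.trans (S.eps_le_rowErr hη w), fun h =>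
        S.eps_eq_rowErr_best w ▸ h _ (S.best_mem_argminRows w).1⟩
    · exact ⟨fun h => ⟨_, (S.best_mem_argminRows w).1, S.eps_eq_rowErr_best w ▸ h⟩,
        fun ⟨η, hη, h⟩ => (S.eps_le_rowErr hη w).trans h⟩
  rw [h]
  refine (isClosed_stdSimplex ℝ (Fin m)).inter (.inter ?_ ?_)
  · exact isClosed_biInter fun η _ => isClosed_le continuous_const (continuous_rowErr η)
  · exact S.rows.toFinite.isClosed_biUnion fun η _ =>
      isClosed_le (continuous_rowErr η) continuous_const

/-- A row that is strictly worse than the best one at w stays worse nearby, and there are only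
finitely many rows. -/
theorem eventually_best_mem_argminRows (w : Fin m → ℝ) :
    ∀ᶠ w' in 𝓝 w, S.best w' ∈ S.argminRows w := by
  have h : ∀ η : Fin m → Bool, ∀ᶠ w' in 𝓝 w, η ∈ S.argminRows w' → η ∈ S.argminRows w := by
    intro η
    by_cases hη : η ∈ S.argminRows w
    · exact Eventually.of_forall fun _ _ => hη
    by_cases hr : η ∈ S.rows
    swap
    · exact Eventually.of_forall fun _ h => absurd h.1 hr
    have hlt : rowErr (S.best w) w < rowErr η w := by
      by_contra! hle
      exact hη ⟨hr, fun η' hη' => hle.trans ((S.best_mem_argminRows w).2 η' hη')⟩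
    filter_upwards [(continuous_rowErr (S.best w)).continuousAt.eventually_lt
      (continuous_rowErr η).continuousAt hlt] with w' hw' hmem
    exact absurd (hmem.2 _ (S.best_mem_argminRows w).1) (not_le.2 hw')
  filter_upwards [eventually_all.2 h] with w' hw'
  exact hw' _ (S.best_mem_argminRows w')

/-- Near w the selected row is one of those minimal at w. It therefore ties at w with `S.best w`,
which rules out the disjoint alternative; the two rows then give the same update throughout G, so
the update locally agrees on K with the continuous `hypUpdate (S.best w)`. -/
theorem continuousOn_update {G K : Set (Fin m → ℝ)} (hG : G ⊆ stdSimplex ℝ (Fin m))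
    (hties : ∀ η ∈ S.rows, ∀ η' ∈ S.rows, S.sigma η ∩ S.sigma η' ∩ G = ∅ ∨
      ∀ w ∈ G, ∑ i, (if η i ≠ η' i then w i else 0) = 0)
    (hKG : K ⊆ G) (hK : K ⊆ S.dom) : ContinuousOn S.update K := by
  intro w hw
  have hc : ContinuousWithinAt (hypUpdate (S.best w)) K w :=
    (continuousAt_hypUpdate (rowErr_best_pos (hK hw))
      (rowErr_best_lt_one (hK hw))).continuousWithinAt
  refine hc.congr_of_eventuallyEq ?_ rfl
  filter_upwards [nhdsWithin_le_nhds (S.eventually_best_mem_argminRows w), self_mem_nhdsWithin]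
    with w' hw' hw'K
  have hb := S.best_mem_argminRows w
  rcases hties _ hw'.1 _ hb.1 with h | h
  · have : w ∈ S.sigma (S.best w') ∩ S.sigma (S.best w) ∩ G :=
      ⟨⟨⟨(hK hw).1, hw'⟩, ⟨(hK hw).1, hb⟩⟩, hKG hw⟩
    rw [h] at this
    exact this.elim
  · exact hypUpdate_eq_of_sum_eq_zero (hG (hKG hw'K)).1 (h w' (hKG hw'K))

theorem exists_isInvariant (hT : S.NoTies) (hA : S.attractor.Nonempty) :
    ∃ μ : Measure (Fin m → ℝ), S.IsInvariant μ := by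
  obtain ⟨G, hG, hGc, hAG, hties⟩ := hT
  -- The attractor itself is not known to be closed. Its closure still lies in the domain because
  -- `core` is closed.
  set K := closure S.attractor with hKdef
  have hKG : K ⊆ G := closure_minimal hAG hGc.isClosed
  have hKdom : K ⊆ S.dom :=
    (closure_minimal S.attractor_subset_core S.isClosed_core).trans S.core_subset_dom
  have hcont : ContinuousOn S.update K := S.continuousOn_update hG hties hKG hKdom
  have hmaps : Set.MapsTo S.update K K :=
    Set.MapsTo.closure_of_continuousOn (fun w hw => update_mem_attractor hw) hcont
  have hKc : IsCompact K := hGc.of_isClosed_subset isClosed_closure hKG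
  have : CompactSpace K := isCompact_iff_compactSpace.1 hKc
  have : Nonempty K := hA.closure.to_subtype
  obtain ⟨ν, hν, hνT⟩ := exists_measurePreserving_of_continuous (hcont.mapsToRestrict hmaps)
  refine ⟨ν.map Subtype.val, Measure.isProbabilityMeasure_map
    measurable_subtype_coe.aemeasurable, ?_, S.measurable_update, ?_⟩
  · refine measure_mono_null (Set.compl_subset_compl.2 hKdom) ?_
    rw [Measure.map_apply measurable_subtype_coe isClosed_closure.measurableSet.compl]
    convert measure_empty (μ := ν)
    ext w
    simp
  · conv_rhs => rw [← hνT.map_eq]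
    rw [Measure.map_map S.measurable_update measurable_subtype_coe,
      Measure.map_map measurable_subtype_coe hνT.measurable]
    rfl

theorem measurableSet_core : MeasurableSet S.core := S.isClosed_core.measurableSet

/-- The 2^m-th iterate sends the domain into `core`; since it preserves μ, `core` itself has full
measure, and so do its preimages under all iterates. -/
theorem ae_iterate_mem_core {μ : Measure (Fin m → ℝ)} (hμ : S.IsInvariant μ) :
    ∀ᵐ w ∂μ, ∀ t : ℕ, S.update^[t] w ∈ S.core := by
  obtain ⟨-, hdom, hT⟩ := hμ
  have h1 : ∀ᵐ w ∂μ, S.update^[2 ^ m] w ∈ S.core := by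
    have : ∀ᵐ w ∂μ, w ∈ S.dom := hdom
    exact this.mono fun w hw => S.iterate_update_mem_core hw
  have h2 : ∀ᵐ w ∂μ, w ∈ S.core := by
    rw [← (hT.iterate (2 ^ m)).map_eq]
    exact (ae_map_iff (hT.iterate (2 ^ m)).aemeasurable S.measurableSet_core).2 h1
  exact ae_all_iff.2 fun t => (hT.iterate t).quasiMeasurePreserving.ae h2

theorem abs_alpha_le {w : Fin m → ℝ} (hw : w ∈ S.core) :
    |S.alpha w| ≤ 1 / 2 * Real.log (1 / (1 / 2) ^ 2 ^ m) := by
  obtain ⟨-, h1, h2⟩ := hw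
  have hc : (0 : ℝ) < (1 / 2) ^ 2 ^ m := by positivity
  have h0 : 0 < S.eps w := hc.trans_le h1
  have h3 : 1 ≤ (1 - S.eps w) / S.eps w := (one_le_div h0).2 (by linarith)
  rw [alpha, abs_mul, abs_of_pos (by norm_num : (0 : ℝ) < 1 / 2), abs_of_nonneg (Real.log_nonneg h3)]
  have h4 : (1 - S.eps w) / S.eps w ≤ 1 / (1 / 2) ^ 2 ^ m :=
    div_le_div₀ zero_le_one (by linarith) hc h1
  gcongr

open scoped Classical in
/-- The coefficient of a round, where the round selects the row `η`, and `0` elsewhere. -/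
noncomputable def rowAlpha (η : Fin m → Bool) (w : Fin m → ℝ) : ℝ :=
  if S.best w = η ∧ w ∈ S.core then S.alpha w else 0

theorem measurable_rowAlpha (η : Fin m → Bool) : Measurable (S.rowAlpha η) :=
  Measurable.ite ((S.measurable_best (measurableSet_singleton η)).inter S.measurableSet_core)
    S.measurable_alpha measurable_const

theorem abs_rowAlpha_le (η : Fin m → Bool) (w : Fin m → ℝ) :
    |S.rowAlpha η w| ≤ |1 / 2 * Real.log (1 / (1 / 2) ^ 2 ^ m)| := by
  unfold rowAlpha
  split_ifs with h
  · exact (S.abs_alpha_le h.2).trans (le_abs_self _)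
  · simp

/-- The hypothesis used in a round depends on the weight only through the selected row. Sorting
rounds by row separates the instance x from the dynamics. -/
theorem F_eq_sum_birkhoffSum {w : Fin m → ℝ} (hw : ∀ t : ℕ, S.update^[t] w ∈ S.core) (T : ℕ)
    (x : X) : S.F w T x = ∑ η, birkhoffSum S.update (S.rowAlpha η) T w * pm (S.rep η x) := by
  simp only [F, birkhoffSum, Finset.sum_mul]
  rw [Finset.sum_comm]
  refine Finset.sum_congr rfl fun t _ => ?_
  rw [Finset.sum_eq_single (S.best (S.update^[t] w))]
  · simp [rowAlpha, hw t]
  · intro η _ hη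
    simp [rowAlpha, hη.symm]
  · simp

/-- Birkhoff's theorem is used once per row, with functions that do not involve x, so a single null
set serves all x even if X is uncountable. -/
theorem ae_isRun_and_tendsto {μ : Measure (Fin m → ℝ)} (hμ : S.IsInvariant μ) :
    ∀ᵐ w ∂μ, S.IsRun w ∧ ∀ x : X, ∃ l : ℝ,
      Tendsto (fun T : ℕ => S.F w T x / T) atTop (𝓝 l) := by
  have := hμ.1
  filter_upwards [S.ae_iterate_mem_core hμ, ae_all_iff.2 fun η =>
    ae_exists_tendsto_birkhoffSum_div hμ.2.2 (S.measurable_rowAlpha η) (S.abs_rowAlpha_le η)]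
    with w hw hl
  refine ⟨fun t => S.core_subset_dom (hw t), fun x => ?_⟩
  choose l hl using hl
  refine ⟨∑ η, l η * pm (S.rep η x), ?_⟩
  simp only [S.F_eq_sum_birkhoffSum hw, Finset.sum_div, mul_div_right_comm]
  exact tendsto_finsetSum _ fun η _ => (hl η).mul_const _

end Setup

/-! ### Convergence of the classifiers and of the generalization error. -/

theorem abs_pm (b : Bool) : |pm b| = 1 := by cases b <;> simp [pm]

theorem abs_sign_le_one (r : ℝ) : |Real.sign r| ≤ 1 := by
  rcases Real.sign_apply_eq r with h | h | h <;> simp [h]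

theorem tendsto_sign_of_tendsto_div {u : ℕ → ℝ} {l : ℝ}
    (hu : Tendsto (fun n : ℕ => u n / n) atTop (𝓝 l)) (hl : l ≠ 0) :
    Tendsto (fun n => Real.sign (u n)) atTop (𝓝 (Real.sign l)) := by
  refine tendsto_const_nhds.congr' ?_
  rcases hl.lt_or_gt with h | h
  · filter_upwards [hu.eventually (gt_mem_nhds h)] with n hn
    rw [Real.sign_of_neg h, Real.sign_of_neg]
    by_contra! h'
    -- No separate case n = 0 is needed: division by zero gives 0, so the strict sign of the
    -- quotient excludes it.
    exact absurd hn (not_lt.2 (div_nonneg h' n.cast_nonneg))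
  · filter_upwards [hu.eventually (lt_mem_nhds h)] with n hn
    rw [Real.sign_of_pos h, Real.sign_of_pos]
    by_contra! h'
    exact absurd hn (not_lt.2 (div_nonpos_of_nonpos_of_nonneg h' n.cast_nonneg))

theorem abs_loss_le_one {X : Type*} {H : X → ℝ} {z : X × Bool} (h : |H z.1| ≤ 1) :
    |loss H z| ≤ 1 := by
  have h1 : |pm z.2 * H z.1| ≤ 1 := by rwa [abs_mul, abs_pm, one_mul]
  rw [abs_le] at h1 ⊢
  unfold loss
  constructor <;> linarith [h1.1, h1.2]

theorem measurable_loss {X : Type*} [MeasurableSpace (X × Bool)]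
    (hlabel : Measurable fun z : X × Bool => z.2) {H : X → ℝ}
    (hH : Measurable fun z : X × Bool => H z.1) : Measurable (loss H) :=
  (((measurable_of_countable pm).comp hlabel).mul hH |>.const_sub 1).div_const 2

end AdaBoost

theorem mainTheorem6 {X : Type*} {m : ℕ} (S : AdaBoost.Setup X m)
    [MeasurableSpace (X × Bool)] (P : Measure (X × Bool)) [IsProbabilityMeasure P]
    (hlabel : Measurable (fun z : X × Bool => z.2)) :
    (S.NoTies → S.attractor.Nonempty → ∃ μ : Measure (Fin m → ℝ), S.IsInvariant μ) ∧
    (∀ μ : Measure (Fin m → ℝ), S.IsInvariant μ → ∀ᵐ w₁ ∂μ,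
      S.IsRun w₁ ∧ ∀ x : X, ∃ l : ℝ, Tendsto (fun T : ℕ => S.F w₁ T x / T) atTop (𝓝 l)) ∧
    (∀ w₁ : Fin m → ℝ, S.IsRun w₁ →
      (∀ T : ℕ, Measurable (fun z : X × Bool => S.H w₁ T z.1)) →
      ∀ Fstar Hstar : X → ℝ,
      (∀ᵐ z ∂P, Tendsto (fun T : ℕ => S.F w₁ T z.1 / T) atTop (𝓝 (Fstar z.1)) ∧
        Fstar z.1 ≠ 0) →
      Hstar = (fun x => Real.sign (Fstar x)) →
        (∀ᵐ z ∂P, Tendsto (fun T : ℕ => S.H w₁ T z.1) atTop (𝓝 (Hstar z.1))) ∧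
        (∀ T : ℕ, Integrable (AdaBoost.loss (S.H w₁ T)) P) ∧
        Integrable (AdaBoost.loss Hstar) P ∧
        Tendsto (fun T : ℕ => AdaBoost.genErr P (S.H w₁ T)) atTop
          (𝓝 (∫ z, AdaBoost.loss Hstar z ∂P))) := by
  refine ⟨S.exists_isInvariant, fun μ hμ => S.ae_isRun_and_tendsto hμ, ?_⟩
  rintro w₁ - hH Fstar Hstar hF rfl
  have hlim : ∀ᵐ z ∂P, Tendsto (fun T : ℕ => S.H w₁ T z.1) atTop (𝓝 (Real.sign (Fstar z.1))) :=
    hF.mono fun z hz => AdaBoost.tendsto_sign_of_tendsto_div hz.1 hz.2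
  have hloss : ∀ᵐ z ∂P, Tendsto (fun T : ℕ => AdaBoost.loss (S.H w₁ T) z) atTop
      (𝓝 (AdaBoost.loss (fun x => Real.sign (Fstar x)) z)) :=
    hlim.mono fun z hz => ((hz.const_mul _).const_sub 1).div_const 2
  have hmeas : ∀ T, AEStronglyMeasurable (AdaBoost.loss (S.H w₁ T)) P := fun T =>
    (AdaBoost.measurable_loss hlabel (hH T)).aestronglyMeasurable
  have hbound : ∀ T, ∀ᵐ z ∂P, ‖AdaBoost.loss (S.H w₁ T) z‖ ≤ 1 := fun T =>
    ae_of_all _ fun z => AdaBoost.abs_loss_le_one (AdaBoost.abs_sign_le_one _)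
  refine ⟨hlim, fun T => .of_bound (hmeas T) 1 (hbound T), ?_, ?_⟩
  -- Measurability of the limiting loss is inherited from the almost everywhere limit, whatever
  -- values `Fstar` takes on the exceptional null set.
  · exact .of_bound (aestronglyMeasurable_of_tendsto_ae atTop hmeas hloss) 1
      (ae_of_all _ fun z => AdaBoost.abs_loss_le_one (AdaBoost.abs_sign_le_one _))
  · exact tendsto_integral_of_dominated_convergence (fun _ => 1) hmeas (integrable_const 1) hbound
      hloss
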